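/- Let $m\ge 1$ and $r\ge 0$ be integers, let $G$ be a finitely generated group, let $\nu\colon G\to\mathbb{Z}^m$ be a surjective group homomorphism, and let $N=\ker(\nu)$. Let $\mathbb{T}_m=\mathrm{Hom}(\mathbb{Z}^m,\mathbb{C}^*)$ be the character torus of $\mathbb{Z}^m$, an algebraic torus with coordinate ring the group algebra $\mathbb{C}[\mathbb{Z}^m]$ (the ring of Laurent polynomials in $m$ variables). For $\rho\in\mathbb{T}_m$ let $\nu^*\rho=\rho\circ\nu\colon G\to\mathbb{C}^*$, and let $\mathbb{C}_{\nu^*\rho}$ be the $G$-module $\mathbb{C}$ on which $g\in G$ acts as multiplication by $\rho(\nu(g))$. Assume that $\dim_{\mathbb{C}} H_i(N,\mathbb{C})<\infty$ for all $0\le i\le r$, where $N$ acts trivially on $\mathbb{C}$. Then there is a non-empty Zariski open subset $U\subset\mathbb{T}_m$ such that $H_i(G,\mathbb{C}_{\nu^*\rho})=0$ for all $\rho\in U$ and all $0\le i\le r$. -/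

import Mathlib

noncomputable section

/-- The character torus `Hom(ℤᵐ, ℂˣ)` of the free abelian group `ℤᵐ`
(written multiplicatively). -/
abbrev CharacterTorus (m : ℕ) : Type :=
  Multiplicative (Fin m → ℤ) →* ℂˣ

namespace CharacterTorus

/-- The coordinate ring of the character torus: the group algebra `ℂ[ℤᵐ]`, that is, the ring of
complex Laurent polynomials in `m` variables. -/
abbrev CoordinateRing (m : ℕ) : Type :=
  MonoidAlgebra ℂ (Multiplicative (Fin m → ℤ))

/-- The value at the character `ρ` of a regular function on the torus: the `ℂ`-algebra
homomorphism `ℂ[ℤᵐ] → ℂ` which extends `ρ`. -/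
def eval {m : ℕ} (ρ : CharacterTorus m) : CoordinateRing m →ₐ[ℂ] ℂ :=
  MonoidAlgebra.lift ℂ ℂ (Multiplicative (Fin m → ℤ)) ((Units.coeHom ℂ).comp ρ)

/-- The set of common zeros in the torus of a set of regular functions. -/
def zeroLocus {m : ℕ} (S : Set (CoordinateRing m)) : Set (CharacterTorus m) :=
  {ρ | ∀ f ∈ S, eval ρ f = 0}

/-- Zariski open subsets of the torus: the complements of the zero loci of sets of regular
functions. -/
def IsZariskiOpen {m : ℕ} (U : Set (CharacterTorus m)) : Prop :=
  ∃ S : Set (CoordinateRing m), U = (zeroLocus S)ᶜ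

end CharacterTorus

/-- The representation of `G` attached to a character `χ : G → ℂˣ`: the vector space `ℂ`, on which
`g` acts as multiplication by `χ g`. -/
def characterRepresentation {G : Type} [Group G] (χ : G →* ℂˣ) : Representation ℂ G ℂ where
  toFun g := (χ g : ℂ) • LinearMap.id
  map_one' := by ext; simp
  map_mul' g h := by ext; simp [mul_comm]

/-- The `G`-module `ℂ_χ`: the one-dimensional representation attached to the character `χ`. -/
abbrev characterRep {G : Type} [Group G] (χ : G →* ℂˣ) : Rep ℂ G :=
  Rep.of (characterRepresentation χ)

end

universe u

open CategoryTheory Polynomial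

/-! Write A = ℂ[ℤᵐ]. Shapiro's lemma (`groupHomologyLaurentIso`) identifies H_i(G, A) with H_i(N,
ℂ), which is finite-dimensional for i ≤ r. Hence, for a coordinate t, one element f = p(t) with p ≠
0 kills H_i(G, A) in all these degrees (`exists_polynomial_smul_boundary_of_le`). The inhomogeneous
chains are free over A, so powers of f are null-homotopic there
(`ChainComplex.exists_homotopy_pow`). The A-linear homotopy survives specialization at ρ, where f
becomes a scalar; if that scalar is nonzero, the homology vanishes
(`subsingleton_groupHomology_mulRep`). So U is the locus f ≠ 0. -/

/-- A subquotient of an `A`-module which is finite-dimensional over `k` is annihilated by a nonzero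
polynomial in any given element of `A`. -/
theorem exists_polynomial_smul_mem {k A V : Type*} [Field k] [CommRing A] [Algebra k A]
    [AddCommGroup V] [Module k V] [Module A V] [IsScalarTower k A V]
    (Z B : Submodule A V) {H : Type*} [AddCommGroup H] [Module k H] [FiniteDimensional k H]
    (q : Z.restrictScalars k →ₗ[k] H) (hq : ∀ z, q z = 0 → (z : V) ∈ B) (t : A) :
    ∃ p : k[X], p ≠ 0 ∧ ∀ z ∈ Z, aeval t p • z ∈ B := by
  let W := Z ⧸ B.submoduleOf Z
  have hfin : FiniteDimensional k W := by
    have : Module.Finite k (Z.restrictScalars k ⧸ LinearMap.ker q) :=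
      Module.Finite.equiv q.quotKerEquivRange.symm
    let mk : Z.restrictScalars k →ₗ[k] W := (B.submoduleOf Z).mkQ.restrictScalars k
    refine Module.Finite.of_surjective ((LinearMap.ker q).liftQ mk fun z hz => ?_) ?_
    · exact (Submodule.Quotient.mk_eq_zero _).2 (hq z hz)
    · intro w
      obtain ⟨z, rfl⟩ := Submodule.mkQ_surjective _ w
      exact ⟨Submodule.Quotient.mk (z : Z.restrictScalars k), rfl⟩
  let T : Module.End k W := Algebra.lsmul k k W t
  refine ⟨minpoly k T, minpoly.ne_zero (Algebra.IsIntegral.isIntegral T), fun z hz => ?_⟩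
  have h : Algebra.lsmul k k W (aeval t (minpoly k T)) = 0 := by
    rw [← Polynomial.aeval_algHom_apply]
    exact minpoly.aeval k T
  have := LinearMap.congr_fun h (Submodule.Quotient.mk ⟨z, hz⟩)
  exact (Submodule.Quotient.mk_eq_zero (B.submoduleOf Z)).1 this

/-- If `f` annihilates the homology of a complex of projective modules in degrees at most `r`, then
in these degrees multiplication by a power of `f` is null-homotopic. -/
theorem ChainComplex.exists_homotopy_pow {R : Type u} [CommRing R]
    (K : ChainComplex (ModuleCat.{u} R) ℕ)
    [∀ n, Module.Projective R (K.X n)] (f : R) (r : ℕ)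
    (hf : ∀ i ≤ r, ∀ x : K.X i, K.d i ((ComplexShape.down ℕ).next i) x = 0 →
      ∃ y, K.d (i + 1) i y = f • x) (i : ℕ) (hi : i ≤ r) :
    ∃ (h : K.X i →ₗ[R] K.X (i + 1)) (h' : K.X ((ComplexShape.down ℕ).next i) →ₗ[R] K.X i),
      ∀ x, f ^ (i + 1) • x =
        K.d (i + 1) i (h x) + h' (K.d i ((ComplexShape.down ℕ).next i) x) := by
  have lift (i : ℕ) (hi : i ≤ r) (φ : K.X i →ₗ[R] K.X i)
      (hφ : ∀ x, K.d i ((ComplexShape.down ℕ).next i) (φ x) = 0) :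
      ∃ h : K.X i →ₗ[R] K.X (i + 1), ∀ x, K.d (i + 1) i (h x) = f • φ x := by
    let D := (K.d (i + 1) i).hom
    let ψ : K.X i →ₗ[R] LinearMap.range D :=
      (f • φ).codRestrict _ fun x => hf i hi (φ x) (hφ x)
    obtain ⟨h, hh⟩ := Module.projective_lifting_property D.rangeRestrict ψ
      D.surjective_rangeRestrict
    exact ⟨h, fun x => congr_arg Subtype.val (LinearMap.congr_fun hh x)⟩
  induction i with
  | zero =>
    have h0 : ∀ x, K.d 0 ((ComplexShape.down ℕ).next 0) x = 0 := fun x => by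
      rw [K.shape _ _ (by simp)]; rfl
    obtain ⟨h, hh⟩ := lift 0 hi LinearMap.id fun x => h0 x
    exact ⟨h, 0, fun x => by simp [hh]⟩
  | succ i ih =>
    obtain ⟨h, h', H⟩ := ih (by omega)
    have hn : (ComplexShape.down ℕ).next (i + 1) = i := ChainComplex.next_nat_succ i
    rw [hn]
    have hdd : ∀ x, K.d i ((ComplexShape.down ℕ).next i) (K.d (i + 1) i x) = 0 := fun x => by
      rw [← ModuleCat.comp_apply, K.d_comp_d]; rfl
    -- The inductive identity at d x says that f ^ (i + 1) - h ∘ d maps into cycles. One more factor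
    -- f makes these boundaries, which raises the exponent by one.
    obtain ⟨s, hs⟩ := lift (i + 1) hi (f ^ (i + 1) • LinearMap.id - h ∘ₗ (K.d (i + 1) i).hom)
      fun x => by
        rw [hn]
        have := H (K.d (i + 1) i x)
        rw [hdd, map_zero, add_zero] at this
        simp [this]
    refine ⟨s, f • h, fun x => ?_⟩
    rw [hs]
    simp [pow_succ', mul_smul, smul_sub]

theorem ChainComplex.subsingleton_homology_iff {R : Type u} [CommRing R]
    (K : ChainComplex (ModuleCat.{u} R) ℕ) (i : ℕ) :
    Subsingleton (K.homology i) ↔ ∀ x : K.X i, K.d i ((ComplexShape.down ℕ).next i) x = 0 →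
      ∃ y, K.d (i + 1) i y = x := by
  rw [← ModuleCat.isZero_iff_subsingleton, ← K.exactAt_iff_isZero_homology,
    K.exactAt_iff' (i + 1) i _ (ChainComplex.prev ℕ i) rfl, ShortComplex.moduleCat_exact_iff]
  rfl

/-- The class map from cycles to homology, whose kernel consists of boundaries. -/
theorem ChainComplex.exists_linearMap_homology {R : Type u} [CommRing R]
    (K : ChainComplex (ModuleCat.{u} R) ℕ) (i : ℕ) :
    ∃ q : LinearMap.ker (K.d i ((ComplexShape.down ℕ).next i)).hom →ₗ[R] K.homology i,
      ∀ z, q z = 0 → ∃ y, K.d (i + 1) i y = z := by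
  let S := K.sc' (i + 1) i ((ComplexShape.down ℕ).next i)
  let e : K.homology i ≅ S.moduleCatLeftHomologyData.H :=
    K.homologyIsoSc' _ _ _ (ChainComplex.prev ℕ i) rfl ≪≫ S.moduleCatHomologyIso
  refine ⟨e.toLinearEquiv.symm.toLinearMap ∘ₗ (LinearMap.range S.moduleCatToCycles).mkQ,
    fun z hz => ?_⟩
  have h : (LinearMap.range S.moduleCatToCycles).mkQ z = 0 :=
    e.toLinearEquiv.symm.map_eq_zero_iff.1 hz
  obtain ⟨y, hy⟩ := (Submodule.Quotient.mk_eq_zero _).1 h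
  exact ⟨y, congr_arg Subtype.val hy⟩

/-! ### Group homology with coefficients in an algebra -/

/-- An algebra `A` over `S`, on which `g : G` acts as multiplication by `χ g`. -/
noncomputable def mulRepresentation (S : Type*) {A G : Type*} [CommRing S] [CommRing A]
    [Algebra S A] [Group G] (χ : G →* A) : Representation S G A :=
  (Algebra.lmul S A : A →* Module.End S A).comp χ

@[simp]
theorem mulRepresentation_apply (S : Type*) {A G : Type*} [CommRing S] [CommRing A]
    [Algebra S A] [Group G] (χ : G →* A) (g : G) (a : A) :
    mulRepresentation S χ g a = χ g * a := rfl

/-- The representation `mulRepresentation` as an object of `Rep S G`. -/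
noncomputable abbrev mulRep (S : Type u) {A G : Type u} [CommRing S] [CommRing A]
    [Algebra S A] [Group G] (χ : G →* A) : Rep.{u} S G :=
  Rep.of (mulRepresentation S χ)

open groupHomology in
/-- A change of coefficients is compatible with the differentials of the inhomogeneous chains. -/
theorem mulRep_d_mapRange {S A G S' A' : Type u} [CommRing S] [CommRing A] [Algebra S A]
    [Group G] [CommRing S'] [CommRing A'] [Algebra S' A'] (χ : G →* A) (ev : A →+* A')
    (i j : ℕ) (x : (Fin i → G) →₀ A) :
    (inhomogeneousChains (mulRep S' ((ev : A →* A').comp χ))).d i j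
        (Finsupp.mapRange.addMonoidHom (ev : A →+ A') x) =
      Finsupp.mapRange.addMonoidHom (ev : A →+ A')
        ((inhomogeneousChains (mulRep S χ)).d i j x : (Fin j → G) →₀ A) := by
  by_cases hij : j + 1 = i
  · subst hij
    rw [inhomogeneousChains.d_def, inhomogeneousChains.d_def]
    induction x using Finsupp.induction_linear with
    | zero => simp
    | add x y hx hy => rw [map_add, map_add, hx, hy, map_add, map_add]
    | single g a =>
      have hs (n : ℕ) (s : Fin n → G) (b : A) : Finsupp.mapRange.addMonoidHom (ev : A →+ A')
          (Finsupp.single s b) = Finsupp.single s (ev b) :=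
        Finsupp.mapRange_single (hf := map_zero ev)
      rw [hs]
      have h1 := inhomogeneousChains.d_single (A := mulRep S χ) j g a
      have h2 := inhomogeneousChains.d_single
        (A := mulRep S' ((ev : A →* A').comp χ)) j g (ev a)
      refine h2.trans (Eq.trans ?_ (congr_arg _ h1).symm)
      rw [map_add, map_sum, hs]
      congr 1
      · simp
      · refine Finset.sum_congr rfl fun l _ => ?_
        -- The signs lie in the unrelated rings `S` and `S'`, so they are compared through their
        -- parity.
        rcases neg_one_pow_eq_or ℤ ((l : ℕ) + 1) with h | h
        · have hS : (-1 : S) ^ ((l : ℕ) + 1) = 1 := by exact_mod_cast congr_arg (Int.cast : ℤ → S) h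
          have hS' : (-1 : S') ^ ((l : ℕ) + 1) = 1 := by
            exact_mod_cast congr_arg (Int.cast : ℤ → S') h
          rw [hS, hS', one_smul, one_smul, hs]
        · have hS : (-1 : S) ^ ((l : ℕ) + 1) = -1 := by exact_mod_cast congr_arg (Int.cast : ℤ → S) h
          have hS' : (-1 : S') ^ ((l : ℕ) + 1) = -1 := by
            exact_mod_cast congr_arg (Int.cast : ℤ → S') h
          rw [hS, hS', neg_smul, neg_smul, one_smul, one_smul, map_neg, hs]
  · have hij' : ¬ (ComplexShape.down ℕ).Rel i j := hij
    rw [HomologicalComplex.shape _ _ _ hij', HomologicalComplex.shape _ _ _ hij']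
    exact (map_zero _).symm

/-! ### Shapiro's lemma -/

open Representation in
/-- For a surjective `ν : G → Q` onto a commutative group, the representation of `G` induced from
the trivial representation of the kernel of `ν` is the group algebra of `Q`. -/
noncomputable def indTrivialEquiv {k G Q : Type u} [CommRing k] [Group G] [CommGroup Q]
    (ν : G →* Q) (hν : Function.Surjective ν) :
    (Representation.ind ν.ker.subtype (Representation.trivial k ν.ker k)).Equiv
      (mulRepresentation k ((MonoidAlgebra.of k Q).comp ν)) := by
  let σ : Q → G := Function.surjInv hν
  have hσ (q : Q) : ν (σ q) = q := Function.surjInv_eq hν q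
  let τ := Representation.trivial k ν.ker k
  -- `G` acts on the induced module by right translation by inverses; inverting ν g turns this into
  -- multiplication by ν.
  let F : IndV ν.ker.subtype τ →ₗ[k] MonoidAlgebra k Q :=
    Coinvariants.lift _ (TensorProduct.lift <| (Finsupp.lift _ _ _ fun g =>
      LinearMap.toSpanSingleton k _ (MonoidAlgebra.of k Q (ν g)⁻¹)) ∘ₗ
      (MonoidAlgebra.coeffLinearEquiv k).toLinearMap) fun n => by
        ext g
        have hn : ν n = 1 := n.2
        simp [hn]
  have hF (g : G) (a : k) : F (IndV.mk ν.ker.subtype τ g a) = MonoidAlgebra.single (ν g)⁻¹ a := by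
    simp [F]
  let E : MonoidAlgebra k Q →ₗ[k] IndV ν.ker.subtype τ :=
    (Finsupp.lift _ _ _ fun q => IndV.mk ν.ker.subtype τ (σ q)⁻¹ 1) ∘ₗ
      (MonoidAlgebra.coeffLinearEquiv k).toLinearMap
  have hE (q : Q) (a : k) : E (MonoidAlgebra.single q a) = IndV.mk ν.ker.subtype τ (σ q)⁻¹ a := by
    have := (IndV.mk ν.ker.subtype τ (σ q)⁻¹).map_smul a 1
    simp only [smul_eq_mul, mul_one] at this
    simp [E, this]
  have hmk (g h : G) (hgh : ν g = ν h) (a : k) :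
      IndV.mk ν.ker.subtype τ g a = IndV.mk ν.ker.subtype τ h a := by
    have hn : g * h⁻¹ ∈ ν.ker := by simp [MonoidHom.mem_ker, hgh]
    refine (Coinvariants.mk_eq_iff _).2 (Coinvariants.mem_ker_of_eq ⟨g * h⁻¹, hn⟩
      (MonoidAlgebra.single h 1 ⊗ₜ a) _ ?_)
    simp [τ]
  refine .mk (LinearEquiv.ofLinearMap F E ?_ ?_) fun g => ?_
  · refine MonoidAlgebra.lhom_ext' fun q => LinearMap.ext fun a => ?_
    change F (E (MonoidAlgebra.single q a)) = MonoidAlgebra.single q a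
    rw [hE, hF, map_inv, inv_inv, hσ]
  · refine IndV.hom_ext _ _ fun g => LinearMap.ext fun a => ?_
    change E (F (IndV.mk ν.ker.subtype τ g a)) = IndV.mk ν.ker.subtype τ g a
    rw [hF, hE]
    exact hmk _ _ (by simp [hσ]) a
  · refine IndV.hom_ext _ _ fun h => LinearMap.ext fun a => ?_
    change F (ind _ _ g (IndV.mk ν.ker.subtype τ h a)) =
      MonoidAlgebra.of k Q (ν g) * F (IndV.mk ν.ker.subtype τ h a)
    rw [ind_mk, hF, hF]
    simp [MonoidAlgebra.single_mul_single]

/-- Shapiro's lemma for the kernel of a surjective homomorphism onto a commutative group. -/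
noncomputable def groupHomologyLaurentIso {k G Q : Type u} [CommRing k] [Group G] [CommGroup Q]
    (ν : G →* Q) (hν : Function.Surjective ν) (n : ℕ) :
    groupHomology (mulRep k ((MonoidAlgebra.of k Q).comp ν)) n ≅
      groupHomology (Rep.trivial k ν.ker k) n := by
  classical exact
  (groupHomology.functor k G n).mapIso (Rep.mkIso (indTrivialEquiv ν hν)).symm ≪≫
    groupHomology.indIso ν.ker (Rep.trivial k ν.ker k) n

/-! ### Annihilation and specialization -/

-- Links the two scalar rings: finiteness is known over `k`, while freeness and the homotopy live
-- over `A`.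
open groupHomology in
theorem mulRep_d_eq (k : Type u) {A G : Type u} [CommRing k] [CommRing A] [Algebra k A]
    [Group G] (χ : G →* A) (i j : ℕ) (x : (Fin i → G) →₀ A) :
    ((inhomogeneousChains (mulRep k χ)).d i j x : (Fin j → G) →₀ A) =
      (inhomogeneousChains (mulRep A χ)).d i j x := by
  have hid (l : ℕ) (y : (Fin l → G) →₀ A) :
      Finsupp.mapRange.addMonoidHom (RingHom.id A : A →+ A) y = y := by
    ext; rfl
  have h := mulRep_d_mapRange (S := A) (S' := k) χ (RingHom.id A) i j x
  rw [hid, hid] at h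
  exact h

open groupHomology in
/-- The differential of the inhomogeneous chains of `mulRep A χ` as a linear map. -/
noncomputable def mulRepD {A G : Type u} [CommRing A] [Group G] (χ : G →* A) (i j : ℕ) :
    ((Fin i → G) →₀ A) →ₗ[A] ((Fin j → G) →₀ A) :=
  ((inhomogeneousChains (mulRep A χ)).d i j).hom

theorem exists_polynomial_smul_mulRepD {k A G : Type u} [Field k] [CommRing A] [Algebra k A]
    [Group G] (χ : G →* A) (t : A) (i : ℕ)
    [hfin : FiniteDimensional k (groupHomology (mulRep k χ) i)] :
    ∃ p : k[X], p ≠ 0 ∧ ∀ x, mulRepD χ i ((ComplexShape.down ℕ).next i) x = 0 →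
      ∃ y, mulRepD χ (i + 1) i y = aeval t p • x := by
  let K := groupHomology.inhomogeneousChains (mulRep k χ)
  obtain ⟨q, hq⟩ := ChainComplex.exists_linearMap_homology K i
  generalize hj : (ComplexShape.down ℕ).next i = j at q hq ⊢
  let ι : (LinearMap.ker (mulRepD χ i j)).restrictScalars k →ₗ[k] LinearMap.ker (K.d i j).hom :=
    LinearMap.codRestrict (LinearMap.ker (K.d i j).hom)
      ((LinearMap.ker (mulRepD χ i j)).restrictScalars k).subtype
      fun z => (mulRep_d_eq k χ i j z).trans z.2
  have : FiniteDimensional k (K.homology i) := hfin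
  have hB (z) (hz : (q ∘ₗ ι) z = 0) : (z : (Fin i → G) →₀ A) ∈
      LinearMap.range (mulRepD χ (i + 1) i) := by
    obtain ⟨y, hy⟩ := hq (ι z) hz
    exact ⟨y, (mulRep_d_eq k χ _ _ y).symm.trans hy⟩
  exact exists_polynomial_smul_mem (LinearMap.ker (mulRepD χ i j))
    (LinearMap.range (mulRepD χ (i + 1) i)) (q ∘ₗ ι) hB t

open groupHomology in
theorem exists_polynomial_smul_boundary {k A G : Type u} [Field k] [CommRing A] [Algebra k A]
    [Group G] (χ : G →* A) (t : A) (i : ℕ)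
    [FiniteDimensional k (groupHomology (mulRep k χ) i)] :
    ∃ p : k[X], p ≠ 0 ∧ ∀ x : (inhomogeneousChains (mulRep A χ)).X i,
      (inhomogeneousChains (mulRep A χ)).d i ((ComplexShape.down ℕ).next i) x = 0 →
      ∃ y, (inhomogeneousChains (mulRep A χ)).d (i + 1) i y = aeval t p • x :=
  exists_polynomial_smul_mulRepD χ t i

open groupHomology in
theorem exists_polynomial_smul_boundary_of_le {k A G : Type u} [Field k] [CommRing A] [Algebra k A]
    [Group G] (χ : G →* A) (t : A) (r : ℕ)
    (hfin : ∀ i ≤ r, FiniteDimensional k (groupHomology (mulRep k χ) i)) :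
    ∃ p : k[X], p ≠ 0 ∧ ∀ i ≤ r, ∀ x : (inhomogeneousChains (mulRep A χ)).X i,
      (inhomogeneousChains (mulRep A χ)).d i ((ComplexShape.down ℕ).next i) x = 0 →
      ∃ y, (inhomogeneousChains (mulRep A χ)).d (i + 1) i y = aeval t p • x := by
  have hex (i : ℕ) (hi : i ≤ r) :=
    have := hfin i hi
    exists_polynomial_smul_boundary (k := k) χ t i
  choose! p hp h using hex
  -- The product of the annihilators found in each degree serves all degrees at once.
  refine ⟨∏ i ∈ Finset.range (r + 1), p i, Finset.prod_ne_zero_iff.2 fun i hi =>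
    hp i (by simpa [Nat.lt_succ_iff] using hi), fun i hi x hx => ?_⟩
  obtain ⟨y, hy⟩ := h i hi x hx
  obtain ⟨s, hs⟩ := Finset.dvd_prod_of_mem p (Finset.mem_range.2 (Nat.lt_succ_of_le hi))
  refine ⟨aeval t s • y, ?_⟩
  rw [map_smul, hy, smul_smul, hs, map_mul, mul_comm]

open groupHomology in
/-- If `f` annihilates the homology of `G` with coefficients in `A` in degrees at most `r`, then
specializing the coefficients to a field in which `f` is nonzero makes the homology vanish in
these degrees. -/
theorem subsingleton_groupHomology_mulRep {A G F : Type u} [CommRing A] [Group G] [Field F]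
    (χ : G →* A) (f : A) (r : ℕ)
    (hf : ∀ i ≤ r, ∀ x : (inhomogeneousChains (mulRep A χ)).X i,
      (inhomogeneousChains (mulRep A χ)).d i ((ComplexShape.down ℕ).next i) x = 0 →
      ∃ y, (inhomogeneousChains (mulRep A χ)).d (i + 1) i y = f • x)
    (ev : A →+* F) (hev : Function.Surjective ev) (hevf : ev f ≠ 0) (i : ℕ) (hi : i ≤ r) :
    Subsingleton (groupHomology (mulRep F ((ev : A →* F).comp χ)) i) := by
  let K := inhomogeneousChains (mulRep A χ)
  let e (n : ℕ) : ((Fin n → G) →₀ A) →+ ((Fin n → G) →₀ F) :=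
    Finsupp.mapRange.addMonoidHom (ev : A →+ F)
  have he (n : ℕ) (a : A) (x : (Fin n → G) →₀ A) : e n (a • x) = ev a • e n x := by
    ext; simp [e]
  have he_surj (n : ℕ) : Function.Surjective (e n) :=
    Finsupp.mapRange_surjective _ (map_zero ev) hev
  -- The homotopy does not come from a map of coefficients; it descends because an `A`-linear map
  -- preserves chains with coefficients in the kernel of `ev`.
  have he_ker (m n : ℕ) (u : ((Fin m → G) →₀ A) →ₗ[A] ((Fin n → G) →₀ A))
      (x : (Fin m → G) →₀ A) (hx : e m x = 0) : e n (u x) = 0 := by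
    rw [← x.sum_single, map_finsuppSum, map_finsuppSum]
    refine Finset.sum_eq_zero fun g _ => ?_
    have hg : ev (x g) = 0 := DFunLike.congr_fun hx g
    have hs : (Finsupp.single g (x g) : (Fin m → G) →₀ A) = x g • Finsupp.single g 1 := by simp
    simp only [hs, map_smul, he, hg, zero_smul]
  have (n : ℕ) : Module.Projective A (K.X n) :=
    inferInstanceAs (Module.Projective A ((Fin n → G) →₀ A))
  obtain ⟨h, h', H⟩ := ChainComplex.exists_homotopy_pow K f r hf i hi
  refine (ChainComplex.subsingleton_homology_iff _ i).2 fun z hz => ?_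
  obtain ⟨x, rfl⟩ := he_surj i z
  have hx : e _ (K.d i ((ComplexShape.down ℕ).next i) x) = 0 :=
    (mulRep_d_mapRange χ ev _ _ x).symm.trans hz
  have h0 := he_ker _ _ h' _ hx
  have hH : (ev f) ^ (i + 1) • e i x = e i (K.d (i + 1) i (h x)) := by
    rw [← map_pow, ← he]
    have := congr_arg (e i) (H x)
    rw [map_add, h0, add_zero] at this
    exact this
  refine ⟨((ev f) ^ (i + 1))⁻¹ • e (i + 1) (h x), ?_⟩
  rw [map_smul]
  refine (congr_arg _ ((mulRep_d_mapRange χ ev _ _ (h x)).trans hH.symm)).trans ?_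
  exact inv_smul_smul₀ (pow_ne_zero _ hevf) _

theorem theorem2p2 {G : Type} [Group G] [Group.FG G] {m : ℕ} (hm : 0 < m)
    (ν : G →* Multiplicative (Fin m → ℤ)) (hν : Function.Surjective ν) (r : ℕ)
    (hN : ∀ i ≤ r, FiniteDimensional ℂ (groupHomology (Rep.trivial ℂ ν.ker ℂ) i)) :
    ∃ U : Set (CharacterTorus m), CharacterTorus.IsZariskiOpen U ∧ U.Nonempty ∧
      ∀ ρ ∈ U, ∀ i ≤ r, Subsingleton (groupHomology (characterRep (ρ.comp ν)) i) := by
  let a : Fin m := ⟨0, hm⟩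
  let t : CharacterTorus.CoordinateRing m :=
    MonoidAlgebra.of ℂ _ (Multiplicative.ofAdd (Pi.single a 1))
  obtain ⟨p, hp, h⟩ := exists_polynomial_smul_boundary_of_le (k := ℂ)
    ((MonoidAlgebra.of ℂ (Multiplicative (Fin m → ℤ))).comp ν) t r fun i hi =>
      have := hN i hi
      Module.Finite.equiv (groupHomologyLaurentIso (k := ℂ) ν hν i).toLinearEquiv.symm
  refine ⟨(CharacterTorus.zeroLocus {aeval t p})ᶜ, ⟨_, rfl⟩, ?_, fun ρ hρ i hi => ?_⟩
  -- The factor `X` also excludes z = 0, so that z is a unit and defines a character.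
  · obtain ⟨z, hz⟩ := (((p * X).roots.toFinset : Set ℂ).toFinite.infinite_compl).nonempty
    have hz' : (p * X).eval z ≠ 0 := fun h0 =>
      hz (by simpa [hp] using h0)
    rw [eval_mul, eval_X] at hz'
    let ρ : CharacterTorus m := (zpowersHom ℂˣ (Units.mk0 z (right_ne_zero_of_mul hz'))).comp
      (AddMonoidHom.toMultiplicative (Pi.evalAddMonoidHom (fun _ : Fin m => ℤ) a))
    refine ⟨ρ, fun h0 => left_ne_zero_of_mul hz' ?_⟩
    have ht : CharacterTorus.eval ρ t = z := by
      simp [CharacterTorus.eval, t, ρ]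
    rw [← h0 _ rfl, ← aeval_algHom_apply, ht, coe_aeval_eq_eval]
  · have hρ' : CharacterTorus.eval ρ (aeval t p) ≠ 0 := by
      simpa [CharacterTorus.zeroLocus] using hρ
    have hrep : characterRepresentation (ρ.comp ν) = mulRepresentation ℂ
        (((CharacterTorus.eval ρ).toRingHom : CharacterTorus.CoordinateRing m →* ℂ).comp
          ((MonoidAlgebra.of ℂ _).comp ν)) := by
      ext g
      simp [characterRepresentation, CharacterTorus.eval]
    rw [characterRep, hrep]
    exact subsingleton_groupHomology_mulRep _ _ r h (CharacterTorus.eval ρ).toRingHom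
      (fun c => ⟨algebraMap ℂ _ c, (CharacterTorus.eval ρ).commutes c⟩) hρ' i hi
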